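/- **Lemma 3.3 (continuity).** Let $S\subset\mathbb R^2$ be a bounded, connected, open, nonempty set (coordinates $(x_2,x_3)$; no regularity of $\partial S$ is needed, so Lipschitz cross-sections are included), and let $\tilde S$ be the union of $S$ and of all bounded connected components of $\mathbb R^2\setminus S$ (that is, $S$ with its holes filled in). Let $c>0$ and let $\mu_{\rm norm},\lambda_{\rm norm}\in\mathbb R$ with $\lambda_{\rm norm}+\mu_{\rm norm}\neq0$. For $\varphi$ in $$\mathcal K:=\{w\in L^1(S):\ w\in[0,1]\ \text{a.e. in }S\}$$ put $u^\varphi:=\varphi(1-c)+c$ on $S$, and $$\hat x_i:=x_i-\frac{\int_S u^\varphi x_i\,dx}{\int_S u^\varphi\,dx}\quad(i=2,3),\qquad D_{x_2}:=\int_S u^\varphi\hat x_2^2\,dx,\quad D_{x_3}:=\int_S u^\varphi\hat x_3^2\,dx,\quad D_{x_2x_3}:=\int_S u^\varphi\hat x_2\hat x_3\,dx,$$ $$E:=\frac{\mu_{\rm norm}(3\lambda_{\rm norm}+2\mu_{\rm norm})}{\lambda_{\rm norm}+\mu_{\rm norm}},\qquad D_{\rm mean}(\varphi):=E\,\frac{D_{x_2}+D_{x_3}}2,\qquad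 RM(\varphi):=E\sqrt{\frac{(D_{x_2}-D_{x_3})^2}{4}+D_{x_2x_3}^2}.$$ Let $\mathcal H:=\{w\in W^{1,2}_0(\tilde S):\ \nabla w=0\ \text{a.e. in }\tilde S\setminus S\}$. Then for every $\varphi\in\mathcal K$ there is exactly one $\Phi=\Phi^\varphi\in\mathcal H$ (the Prandtl stress function) such that $$\int_{\tilde S}\frac1{u^\varphi}\nabla\Phi\cdot\nabla w\,dx=2\int_{\tilde S}w\,dx\qquad\text{for all }w\in\mathcal H$$ (the integrand on the left is zero a.e. outside $S$). Moreover, with $D_T(\varphi):=2\int_{\tilde S}\Phi^\varphi\,dx$, the functional $$\varphi\longmapsto\sigma_1D_{\rm mean}(\varphi)+\sigma_2RM(\varphi)+\mu_{\rm norm}\sigma_3D_T(\varphi)$$ is continuous on $\mathcal K$ with respect to the strong topology of $L^1(S)$, for all $\sigma_1,\sigma_2,\sigma_3\in\mathbb R$. -/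

import Mathlib

open MeasureTheory Filter Topology
open scoped ContDiff

noncomputable section

namespace Rod

/-- The plane with coordinates `(x₂, x₃) = (x 0, x 1)` and the Euclidean norm. -/
abbrev Plane : Type := EuclideanSpace ℝ (Fin 2)

/-! ### Sobolev spaces -/

/-- `ψ ∈ C_c^∞(U)`. -/
def IsTestFunction (U : Set Plane) (ψ : Plane → ℝ) : Prop :=
  ContDiff ℝ ∞ ψ ∧ HasCompactSupport ψ ∧ tsupport ψ ⊆ U

/-- The Hilbert space `L²(U) × L²(U; ℝ²)`, with norm `(‖w‖² + ‖g‖²)^{1/2}`. -/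
abbrev L2Pair (U : Set Plane) : Type :=
  WithLp 2 (Lp ℝ 2 (volume.restrict U) × Lp Plane 2 (volume.restrict U))

/-- `g` is the weak (distributional) gradient of `w` in `U`:
`∫_U w ∇ψ = - ∫_U ψ g` for all `ψ ∈ C_c^∞(U)` (an identity of vectors in the plane). -/
def IsWeakGradient (U : Set Plane) (w : Lp ℝ 2 (volume.restrict U))
    (g : Lp Plane 2 (volume.restrict U)) : Prop :=
  ∀ ψ : Plane → ℝ, IsTestFunction U ψ →
    ∫ x in U, w x • gradient ψ x = - ∫ x in U, ψ x • g x

theorem IsTestFunction.continuous_gradient {U : Set Plane} {ψ : Plane → ℝ}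
    (h : IsTestFunction U ψ) : Continuous (gradient ψ) := by
  have : Continuous (fderiv ℝ ψ) := h.1.continuous_fderiv (by simp)
  exact (InnerProductSpace.toDual ℝ Plane).symm.continuous.comp this

theorem IsTestFunction.hasCompactSupport_gradient {U : Set Plane} {ψ : Plane → ℝ}
    (h : IsTestFunction U ψ) : HasCompactSupport (gradient ψ) := by
  have : HasCompactSupport (fderiv ℝ ψ) := h.2.1.fderiv ℝ
  exact this.comp_left (g := (InnerProductSpace.toDual ℝ Plane).symm) (map_zero _)

theorem IsTestFunction.integrable_smul_gradient {U : Set Plane} {ψ : Plane → ℝ}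
    (h : IsTestFunction U ψ) (w : Lp ℝ 2 (volume.restrict U)) :
    Integrable (fun x => w x • gradient ψ x) (volume.restrict U) :=
  memLp_one_iff_integrable.1 <|
    (h.continuous_gradient.memLp_of_hasCompactSupport (p := 2)
      h.hasCompactSupport_gradient).smul (p := 2) (Lp.memLp w)

theorem IsTestFunction.integrable_smul {U : Set Plane} {ψ : Plane → ℝ}
    (h : IsTestFunction U ψ) (g : Lp Plane 2 (volume.restrict U)) :
    Integrable (fun x => ψ x • g x) (volume.restrict U) :=
  memLp_one_iff_integrable.1 <|
    (Lp.memLp g).smul (p := 2) (h.1.continuous.memLp_of_hasCompactSupport (p := 2) h.2.1)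

/-- The Sobolev space `W^{1,2}(U)`. An element is recorded as the pair `(w, ∇w)` of a function
`w ∈ L²(U)` and its weak gradient `∇w ∈ L²(U; ℝ²)` (which is determined by `w` when `U` is open);
the norm inherited from `L2Pair U` is the usual norm of `W^{1,2}(U)`. -/
def W12 (U : Set Plane) : Submodule ℝ (L2Pair U) where
  carrier := {p | IsWeakGradient U p.fst p.snd}
  zero_mem' := by
    intro ψ hψ
    have h1 : (fun x => (0 : Lp ℝ 2 (volume.restrict U)) x • gradient ψ x)
        =ᵐ[volume.restrict U] fun _ => (0 : Plane) := by
      filter_upwards [Lp.coeFn_zero ℝ 2 (volume.restrict U)] with x hx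
      rw [hx, Pi.zero_apply, zero_smul]
    have h2 : (fun x => ψ x • (0 : Lp Plane 2 (volume.restrict U)) x)
        =ᵐ[volume.restrict U] fun _ => (0 : Plane) := by
      filter_upwards [Lp.coeFn_zero Plane 2 (volume.restrict U)] with x hx
      rw [hx, Pi.zero_apply, smul_zero]
    simp only [WithLp.zero_fst, WithLp.zero_snd]
    rw [integral_congr_ae h1, integral_congr_ae h2]
    simp
  add_mem' := by
    intro p q hp hq ψ hψ
    have h1 : (fun x => (p.fst + q.fst) x • gradient ψ x)
        =ᵐ[volume.restrict U] fun x => p.fst x • gradient ψ x + q.fst x • gradient ψ x := by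
      filter_upwards [Lp.coeFn_add p.fst q.fst] with x hx
      rw [hx, Pi.add_apply, add_smul]
    have h2 : (fun x => ψ x • (p.snd + q.snd) x)
        =ᵐ[volume.restrict U] fun x => ψ x • p.snd x + ψ x • q.snd x := by
      filter_upwards [Lp.coeFn_add p.snd q.snd] with x hx
      rw [hx, Pi.add_apply, smul_add]
    simp only [WithLp.add_fst, WithLp.add_snd]
    rw [integral_congr_ae h1, integral_congr_ae h2,
      integral_add (hψ.integrable_smul_gradient _) (hψ.integrable_smul_gradient _),
      integral_add (hψ.integrable_smul _) (hψ.integrable_smul _), hp ψ hψ, hq ψ hψ, neg_add]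
  smul_mem' := by
    intro a p hp ψ hψ
    have h1 : (fun x => (a • p.fst) x • gradient ψ x)
        =ᵐ[volume.restrict U] fun x => a • (p.fst x • gradient ψ x) := by
      filter_upwards [Lp.coeFn_smul a p.fst] with x hx
      rw [hx, Pi.smul_apply, smul_assoc]
    have h2 : (fun x => ψ x • (a • p.snd) x)
        =ᵐ[volume.restrict U] fun x => a • (ψ x • p.snd x) := by
      filter_upwards [Lp.coeFn_smul a p.snd] with x hx
      rw [hx, Pi.smul_apply, smul_comm]
    simp only [WithLp.smul_fst, WithLp.smul_snd]
    rw [integral_congr_ae h1, integral_congr_ae h2, integral_smul, integral_smul, hp ψ hψ,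
      smul_neg]

/-- The classes of the pairs `(ψ, ∇ψ)` with `ψ ∈ C_c^∞(U)`. -/
def testPairs (U : Set Plane) : Set (L2Pair U) :=
  {p | ∃ ψ : Plane → ℝ, IsTestFunction U ψ ∧
    p.fst =ᵐ[volume.restrict U] ψ ∧ p.snd =ᵐ[volume.restrict U] gradient ψ}

/-- `W^{1,2}_0(U)`: the closure of `C_c^∞(U)` in `W^{1,2}(U)`. -/
def W12Zero (U : Set Plane) : Set (L2Pair U) :=
  {p | p ∈ W12 U ∧ p ∈ closure (testPairs U)}

/-! ### The cross-section and Prandtl's stress function -/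

/-- The set enclosed by the outer boundary of `S`: `S` together with all its holes, the holes
being the bounded connected components of the complement of `S`. -/
def filled (S : Set Plane) : Set Plane :=
  S ∪ {x | x ∈ Sᶜ ∧ Bornology.IsBounded (connectedComponentIn Sᶜ x)}

/-- The space `{w ∈ W^{1,2}_0(S̃) : ∇w = 0 a.e. in S̃ ∖ S}`, where `S̃ = filled S`. -/
def admissibleStress (S : Set Plane) : Set (L2Pair (filled S)) :=
  {w | w ∈ W12Zero (filled S) ∧ ∀ᵐ x ∂(volume.restrict (filled S \ S)), w.snd x = 0}

/-- The material density `u^φ = φ (1 - c) + c` on `S`. -/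
def density (S : Set Plane) (c : ℝ) (φ : Lp ℝ 1 (volume.restrict S)) (x : Plane) : ℝ :=
  φ x * (1 - c) + c

/-- `Φ` is a Prandtl stress function associated with `φ`: it lies in the admissible space and
`∫_{S̃} (1/u^φ) ∇Φ · ∇w = 2 ∫_{S̃} w` for all admissible `w`. (The values of `u^φ` outside `S` are
immaterial, because both gradients vanish a.e. there.) -/
def IsPrandtlStress (S : Set Plane) (c : ℝ) (φ : Lp ℝ 1 (volume.restrict S))
    (Φ : L2Pair (filled S)) : Prop :=
  Φ ∈ admissibleStress S ∧ ∀ w ∈ admissibleStress S,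
    ∫ x in filled S, (1 / density S c φ x) * inner ℝ (Φ.snd x) (w.snd x)
      = 2 * ∫ x in filled S, w.fst x

/-- The Prandtl stress function associated with `φ` (an arbitrary choice is made when there is
none or more than one). -/
def prandtlStress (S : Set Plane) (c : ℝ) (φ : Lp ℝ 1 (volume.restrict S)) : L2Pair (filled S) :=
  Classical.epsilon (IsPrandtlStress S c φ)

/-- The torsional rigidity `D_T(φ) = 2 ∫_{S̃} Φ`. -/
def torsionalRigidity (S : Set Plane) (c : ℝ) (φ : Lp ℝ 1 (volume.restrict S)) : ℝ :=
  2 * ∫ x in filled S, (prandtlStress S c φ).fst x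

/-! ### Bending rigidities -/

/-- The `i`-th coordinate of the centre of mass, `∫_S u^φ x_i / ∫_S u^φ`. -/
def centroid (S : Set Plane) (c : ℝ) (φ : Lp ℝ 1 (volume.restrict S)) (i : Fin 2) : ℝ :=
  (∫ x in S, density S c φ x * x i) / ∫ x in S, density S c φ x

/-- The moments of inertia `∫_S u^φ x̂_i x̂_j`, in the centred coordinates
`x̂_i = x_i - ∫_S u^φ x_i / ∫_S u^φ`. -/
def inertia (S : Set Plane) (c : ℝ) (φ : Lp ℝ 1 (volume.restrict S)) (i j : Fin 2) : ℝ :=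
  ∫ x in S, density S c φ x * (x i - centroid S c φ i) * (x j - centroid S c φ j)

/-- The modulus `μ (3 λ + 2 μ) / (λ + μ)` in terms of the Lamé constants. -/
def youngModulus (mu lam : ℝ) : ℝ :=
  mu * (3 * lam + 2 * mu) / (lam + mu)

/-- The mean bending rigidity `D_mean`. -/
def meanRigidity (S : Set Plane) (c mu lam : ℝ) (φ : Lp ℝ 1 (volume.restrict S)) : ℝ :=
  youngModulus mu lam * ((inertia S c φ 0 0 + inertia S c φ 1 1) / 2)

/-- The non-symmetric part `RM` of the bending rigidity. -/
def nonsymmetricRigidity (S : Set Plane) (c mu lam : ℝ) (φ : Lp ℝ 1 (volume.restrict S)) : ℝ :=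
  youngModulus mu lam *
    Real.sqrt ((inertia S c φ 0 0 - inertia S c φ 1 1) ^ 2 / 4 + inertia S c φ 0 1 ^ 2)

/-- `{w ∈ L¹(S) : w ∈ [0,1] a.e. in S}`. -/
def phaseFields (S : Set Plane) : Set (Lp ℝ 1 (volume.restrict S)) :=
  {φ | ∀ᵐ x ∂(volume.restrict S), φ x ∈ Set.Icc (0 : ℝ) 1}

end Rod

end

noncomputable section

namespace Rod

/-! ### The filled cross-section -/

/-! Existence and uniqueness follow from Lax–Milgram on the closed subspace of admissible pairs
(`isClosed_stressSubmodule`): `1 / u^φ ≥ 1 / max 1 c` controls the gradient, and `exists_poincare`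
controls the full norm by the gradient.

The torsional rigidity is handled without convergence of the stress functions. Testing each of the
two equations with the other solution and subtracting gives `D_T(ψ) - D_T(φ) = ∫ (1/u^φ - 1/u^ψ)
∇Φ^φ · ∇Φ^ψ` (`torsionalRigidity_sub`). By Cauchy–Schwarz this is at most `‖(1/u^φ - 1/u^ψ) ∇Φ^φ‖
‖∇Φ^ψ‖`. The second factor is bounded uniformly in `ψ` (`exists_norm_prandtlStress_le`). In the
first, the field `∇Φ^φ` is fixed and square integrable and the coefficients are bounded, so
dominated convergence sends it to zero although the coefficients need not converge uniformly.

The moments of inertia are polynomials in the centroid and in integrals of `u^φ` against fixed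
weights (`inertia_eq`). Those integrals, like the first factor above, are continuous by
`continuousOn_setIntegral`. -/

theorem subset_filled (S : Set Plane) : S ⊆ filled S := Set.subset_union_left

/-- A point outside a ball containing `S` can be joined to infinity outside `S` by a ray. -/
theorem isBounded_filled {S : Set Plane} (hS : Bornology.IsBounded S) :
    Bornology.IsBounded (filled S) := by
  obtain ⟨r, hr⟩ := hS.subset_closedBall (0 : Plane)
  refine (Metric.isBounded_closedBall (x := (0 : Plane)) (r := max r 0)).subset ?_
  rintro x (hx | ⟨hx, hb⟩)
  · exact Metric.closedBall_subset_closedBall (le_max_left _ _) (hr hx)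
  by_contra hxr
  rw [mem_closedBall_zero_iff, not_le, max_lt_iff] at hxr
  have hray : (fun t : ℝ => t • x) '' Set.Ici 1 ⊆ connectedComponentIn Sᶜ x := by
    refine IsPreconnected.subset_connectedComponentIn
      (isPreconnected_Ici.image _ (by fun_prop)) ⟨1, by simp, by simp⟩ ?_
    rintro _ ⟨t, ht, rfl⟩ htS
    have h1 := hr htS
    rw [mem_closedBall_zero_iff, norm_smul, Real.norm_of_nonneg (zero_le_one.trans ht)] at h1
    have ht' : (1 : ℝ) ≤ t := ht
    nlinarith [hxr.1, norm_nonneg x]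
  obtain ⟨R, hR⟩ := (hb.subset hray).exists_norm_le
  -- This point of the ray has norm at least `R + 1`, beyond the supposed bound `R` on the
  -- component.
  have h2 := hR ((max 1 ((R + 1) / ‖x‖)) • x) ⟨_, by simp, rfl⟩
  rw [norm_smul, Real.norm_of_nonneg (by positivity)] at h2
  have h3 : (R + 1) / ‖x‖ * ‖x‖ ≤ max 1 ((R + 1) / ‖x‖) * ‖x‖ := by gcongr; exact le_max_right _ _
  rw [div_mul_cancel₀ _ hxr.2.ne'] at h3
  linarith

theorem isFiniteMeasure_restrict {U : Set Plane} (hU : Bornology.IsBounded U) :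
    IsFiniteMeasure (volume.restrict U) :=
  ⟨by simpa using hU.measure_lt_top⟩

/-! ### Closed subspaces of Sobolev pairs -/

variable {U : Set Plane}

theorem IsTestFunction.zero : IsTestFunction U (fun _ => 0) :=
  ⟨contDiff_const, HasCompactSupport.zero,
    (tsupport_eq_empty_iff.2 rfl).subset.trans (Set.empty_subset U)⟩

theorem IsTestFunction.add {f g : Plane → ℝ} (hf : IsTestFunction U f) (hg : IsTestFunction U g) :
    IsTestFunction U (f + g) :=
  ⟨hf.1.add hg.1, hf.2.1.add hg.2.1,
    (tsupport_add f g).trans (Set.union_subset hf.2.2 hg.2.2)⟩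

theorem IsTestFunction.smul {f : Plane → ℝ} (a : ℝ) (hf : IsTestFunction U f) :
    IsTestFunction U (a • f) :=
  ⟨contDiff_const.smul hf.1, hf.2.1.smul_left (f := fun _ => a),
    (tsupport_smul_subset_right (fun _ => a) f).trans hf.2.2⟩

theorem IsTestFunction.differentiable {f : Plane → ℝ} (hf : IsTestFunction U f) :
    Differentiable ℝ f := hf.1.differentiable (by simp)

theorem norm_gradient_eq_norm_fderiv (f : Plane → ℝ) (x : Plane) :
    ‖gradient f x‖ = ‖fderiv ℝ f x‖ := by
  simp [gradient]

/-- The pairs `(ψ, ∇ψ)` with `ψ ∈ C_c^∞(U)` form a subspace. -/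
def testSubmodule (U : Set Plane) : Submodule ℝ (L2Pair U) where
  carrier := testPairs U
  zero_mem' := by
    refine ⟨fun _ => 0, .zero, ?_, ?_⟩
    · exact Lp.coeFn_zero ..
    · have : gradient (fun _ : Plane => (0 : ℝ)) = 0 := by ext1 x; simp [gradient]
      rw [this]; exact Lp.coeFn_zero ..
  add_mem' := by
    rintro p q ⟨f, hf, hp1, hp2⟩ ⟨g, hg, hq1, hq2⟩
    refine ⟨f + g, hf.add hg, ?_, ?_⟩
    · exact (Lp.coeFn_add p.fst q.fst).trans (hp1.add hq1)
    · have : gradient (f + g) = gradient f + gradient g := by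
        ext1 x
        simp [gradient, fderiv_add (hf.differentiable x) (hg.differentiable x)]
      rw [this]
      exact (Lp.coeFn_add p.snd q.snd).trans (hp2.add hq2)
  smul_mem' := by
    rintro a p ⟨f, hf, hp1, hp2⟩
    refine ⟨a • f, hf.smul a, ?_, ?_⟩
    · exact (Lp.coeFn_smul a p.fst).trans (hp1.const_smul a)
    · have : gradient (a • f) = a • gradient f := by
        ext1 x
        simp [gradient, fderiv_const_smul (hf.differentiable x)]
      rw [this]
      exact (Lp.coeFn_smul a p.snd).trans (hp2.const_smul a)

theorem continuous_fst_L2Pair : Continuous fun p : L2Pair U => p.fst :=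
  (WithLp.prod_continuous_ofLp 2 _ _).fst

theorem continuous_snd_L2Pair : Continuous fun p : L2Pair U => p.snd :=
  (WithLp.prod_continuous_ofLp 2 _ _).snd

/-- For a fixed test function both sides of the weak-gradient identity are `L²` pairings, hence
continuous in the pair; the space is an intersection of closed conditions. -/
theorem isClosed_W12 (U : Set Plane) : IsClosed (W12 U : Set (L2Pair U)) := by
  have : (W12 U : Set (L2Pair U)) = ⋂ (ψ : Plane → ℝ) (_ : IsTestFunction U ψ),
      {p | ∫ x in U, p.fst x • gradient ψ x = - ∫ x in U, ψ x • p.snd x} := by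
    ext p
    simp only [Set.mem_iInter]
    rfl
  rw [this]
  refine isClosed_iInter fun ψ => isClosed_iInter fun hψ => ?_
  have m1 : MemLp (gradient ψ) 2 (volume.restrict U) :=
    hψ.continuous_gradient.memLp_of_hasCompactSupport hψ.hasCompactSupport_gradient
  have m2 : MemLp ψ 2 (volume.restrict U) :=
    hψ.1.continuous.memLp_of_hasCompactSupport hψ.2.1
  set B : ℝ →L[ℝ] Plane →L[ℝ] Plane := ContinuousLinearMap.lsmul ℝ ℝ
  have h1 : ∀ p : L2Pair U, ∫ x in U, p.fst x • gradient ψ x =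
      B.lpPairing (volume.restrict U) 2 2 p.fst m1.toLp := fun p => by
    rw [ContinuousLinearMap.lpPairing_eq_integral]
    refine integral_congr_ae ?_
    filter_upwards [m1.coeFn_toLp] with x hx
    rw [hx]; rfl
  have h2 : ∀ p : L2Pair U, ∫ x in U, ψ x • p.snd x =
      B.lpPairing (volume.restrict U) 2 2 m2.toLp p.snd := fun p => by
    rw [ContinuousLinearMap.lpPairing_eq_integral]
    refine integral_congr_ae ?_
    filter_upwards [m2.coeFn_toLp] with x hx
    rw [hx]; rfl
  simp only [h1, h2]
  refine isClosed_eq ?_ ?_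
  · exact ((ContinuousLinearMap.continuous _).comp continuous_fst_L2Pair).clm_apply continuous_const
  · exact ((ContinuousLinearMap.continuous _).comp continuous_snd_L2Pair).neg

/-- Multiplication of `L²` vector fields by an essentially bounded function. -/
def mulField {κ : Plane → ℝ} (hκ : MemLp κ ⊤ (volume.restrict U)) :
    Lp Plane 2 (volume.restrict U) →L[ℝ] Lp Plane 2 (volume.restrict U) :=
  (ContinuousLinearMap.lsmul ℝ ℝ : ℝ →L[ℝ] Plane →L[ℝ] Plane).holderL
    (volume.restrict U) ⊤ 2 2 hκ.toLp

theorem coeFn_mulField {κ : Plane → ℝ} (hκ : MemLp κ ⊤ (volume.restrict U))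
    (g : Lp Plane 2 (volume.restrict U)) :
    mulField hκ g =ᵐ[volume.restrict U] fun x => κ x • g x := by
  filter_upwards [ContinuousLinearMap.coeFn_holder (r := 2)
    (ContinuousLinearMap.lsmul ℝ ℝ : ℝ →L[ℝ] Plane →L[ℝ] Plane) hκ.toLp g, hκ.coeFn_toLp]
    with x h1 h2
  rw [mulField, ContinuousLinearMap.holderL_apply_apply, h1, h2]
  rfl

theorem inner_mulField {κ : Plane → ℝ} (hκ : MemLp κ ⊤ (volume.restrict U))
    (g h : Lp Plane 2 (volume.restrict U)) :
    inner ℝ (mulField hκ g) h = ∫ x in U, κ x * inner ℝ (g x) (h x) := by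
  rw [L2.inner_def]
  refine integral_congr_ae ?_
  filter_upwards [coeFn_mulField hκ g] with x hx
  rw [hx, real_inner_smul_left]

theorem norm_sq_eq_integral (g : Lp Plane 2 (volume.restrict U)) :
    ‖g‖ ^ 2 = ∫ x in U, ‖g x‖ ^ 2 := by
  rw [← real_inner_self_eq_norm_sq, L2.inner_def]
  simp_rw [real_inner_self_eq_norm_sq]

theorem memLp_indicator_compl {S : Set Plane} (hS : MeasurableSet S) :
    MemLp (Sᶜ.indicator fun _ => (1 : ℝ)) ⊤ (volume.restrict U) :=
  (memLp_top_const 1).indicator hS.compl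

theorem ae_restrict_diff_iff {S : Set Plane} (hS : MeasurableSet S) {P : Plane → Prop} :
    (∀ᵐ x ∂volume.restrict (U \ S), P x) ↔ ∀ᵐ x ∂volume.restrict U, x ∉ S → P x := by
  rw [Set.sdiff_eq, Set.inter_comm, ← Measure.restrict_restrict hS.compl,
    ae_restrict_iff' hS.compl]
  rfl

/-- Turns the almost-everywhere constraint into the kernel of a continuous linear map, so that
linearity and closedness of the admissible space come for free. -/
theorem mulField_indicator_eq_zero_iff {S : Set Plane} (hS : MeasurableSet S)
    (g : Lp Plane 2 (volume.restrict U)) :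
    mulField (memLp_indicator_compl hS) g = 0 ↔ ∀ᵐ x ∂volume.restrict (U \ S), g x = 0 := by
  rw [Lp.eq_zero_iff_ae_eq_zero, ae_restrict_diff_iff hS]
  have h := coeFn_mulField (memLp_indicator_compl (U := U) hS) g
  constructor
  · intro h0
    filter_upwards [h, h0] with x h1 h2 hx
    rw [h2] at h1
    simpa [hx] using h1.symm
  · intro h0
    filter_upwards [h, h0] with x h1 h2
    rw [h1]
    by_cases hx : x ∈ S
    · simp [hx]
    · simp [h2 hx]

/-- `admissibleStress S` as a submodule. -/
def stressSubmodule {S : Set Plane} (hS : MeasurableSet S) : Submodule ℝ (L2Pair (filled S)) :=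
  (W12 (filled S) ⊓ (testSubmodule (filled S)).topologicalClosure) ⊓
    (mulField (memLp_indicator_compl hS) ∘L WithLp.sndL 2 ℝ _ _).ker

theorem mem_stressSubmodule {S : Set Plane} (hS : MeasurableSet S) {w : L2Pair (filled S)} :
    w ∈ stressSubmodule hS ↔ w ∈ admissibleStress S :=
  and_congr Iff.rfl (mulField_indicator_eq_zero_iff hS w.snd)

theorem isClosed_stressSubmodule {S : Set Plane} (hS : MeasurableSet S) :
    IsClosed (stressSubmodule hS : Set (L2Pair (filled S))) :=
  ((isClosed_W12 _).inter (Submodule.isClosed_topologicalClosure _)).inter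
    (ContinuousLinearMap.isClosed_ker _)

/-! ### The Poincaré inequality -/

/-- The Gagliardo–Nirenberg–Sobolev inequality for `W^{1,1}` in the plane. -/
theorem IsTestFunction.eLpNorm_two_le (hU : Bornology.IsBounded U) {ψ : Plane → ℝ}
    (hψ : IsTestFunction U ψ) :
    eLpNorm ψ 2 (volume.restrict U) ≤
      eLpNormLESNormFDerivOfLeConst ℝ (volume : Measure Plane) U 1 2 *
        eLpNorm (gradient ψ) 1 (volume.restrict U) := by
  have hsupp : Function.support (gradient ψ) ⊆ U := fun x hx => by
    refine hψ.2.2 (support_fderiv_subset ℝ (f := ψ) fun h => hx ?_)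
    simp [gradient, h]
  -- In dimension 2 the Sobolev conjugate of `p = 1` is exactly `2`; the exponent `p = 2` itself is
  -- excluded, since `p` must be below the dimension.
  have h1 := eLpNorm_le_eLpNorm_fderiv_of_le (volume : Measure Plane) (p := 1) (q := 2)
    (hψ.1.of_le (by exact_mod_cast le_top)) ((subset_tsupport ψ).trans hψ.2.2) le_rfl
    (by simp) (by simp; norm_num) hU
  rw [ENNReal.coe_one, ENNReal.coe_ofNat] at h1
  rw [eLpNorm_restrict_eq_of_support_subset hsupp,
    eLpNorm_restrict_eq_of_support_subset ((subset_tsupport ψ).trans hψ.2.2)]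
  rwa [eLpNorm_congr_norm_ae (g := fderiv ℝ ψ) (.of_forall (norm_gradient_eq_norm_fderiv ψ))]

/-- The Poincaré inequality on `W^{1,2}_0(U)` for bounded `U`. -/
theorem exists_poincare (hU : Bornology.IsBounded U) :
    ∃ C : ℝ, 0 ≤ C ∧ ∀ p ∈ W12Zero U, ‖p.fst‖ ≤ C * ‖p.snd‖ := by
  have := isFiniteMeasure_restrict hU
  obtain ⟨K, hK, hle⟩ : ∃ K : ENNReal, K ≠ ⊤ ∧ ∀ ψ, IsTestFunction U ψ →
      eLpNorm ψ 2 (volume.restrict U) ≤ K * eLpNorm (gradient ψ) 2 (volume.restrict U) := by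
    refine ⟨eLpNormLESNormFDerivOfLeConst ℝ (volume : Measure Plane) U 1 2 *
      (volume.restrict U) Set.univ ^ (1 / (1 : ENNReal).toReal - 1 / (2 : ENNReal).toReal),
      ENNReal.mul_ne_top ENNReal.coe_ne_top
        (ENNReal.rpow_ne_top_of_nonneg (by norm_num) (measure_ne_top _ _)), fun ψ hψ => ?_⟩
    refine (hψ.eLpNorm_two_le hU).trans ?_
    rw [mul_assoc, mul_comm (_ ^ _)]
    gcongr
    exact eLpNorm_le_eLpNorm_mul_rpow_measure_univ one_le_two
      hψ.continuous_gradient.aestronglyMeasurable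
  refine ⟨K.toReal, ENNReal.toReal_nonneg, fun p hp => ?_⟩
  -- The inequality is a closed condition on pairs, so it suffices to check it on test pairs.
  refine closure_minimal (t := {p : L2Pair U | ‖p.fst‖ ≤ K.toReal * ‖p.snd‖}) ?_
    (isClosed_le continuous_fst_L2Pair.norm (continuous_const.mul continuous_snd_L2Pair.norm)) hp.2
  rintro q ⟨ψ, hψ, h1, h2⟩
  change ‖q.fst‖ ≤ K.toReal * ‖q.snd‖
  rw [Lp.norm_def, Lp.norm_def, ← ENNReal.toReal_mul]
  refine ENNReal.toReal_mono (ENNReal.mul_ne_top hK (Lp.eLpNorm_ne_top _)) ?_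
  rw [eLpNorm_congr_ae h1, eLpNorm_congr_ae h2]
  exact hle ψ hψ

/-! ### Bounds on the density -/

/-- The expression is the convex combination `t * 1 + (1 - t) * c`. -/
theorem density_bounds {c t : ℝ} (ht : t ∈ Set.Icc (0 : ℝ) 1) :
    min 1 c ≤ t * (1 - c) + c ∧ t * (1 - c) + c ≤ max 1 c := by
  obtain ⟨h0, h1⟩ := ht
  constructor
  · nlinarith [min_le_left 1 c, min_le_right 1 c]
  · nlinarith [le_max_left 1 c, le_max_right 1 c]

theorem density_pos {c t : ℝ} (hc : 0 < c) (ht : t ∈ Set.Icc (0 : ℝ) 1) :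
    0 < t * (1 - c) + c := (lt_min one_pos hc).trans_le (density_bounds ht).1

theorem norm_density_le {c t : ℝ} (ht : t ∈ Set.Icc (0 : ℝ) 1) :
    ‖t * (1 - c) + c‖ ≤ |1 - c| + |c| := by
  refine (norm_add_le _ _).trans ?_
  rw [norm_mul, Real.norm_of_nonneg ht.1, Real.norm_eq_abs, Real.norm_eq_abs]
  gcongr
  exact mul_le_of_le_one_left (abs_nonneg _) ht.2

/-- The coefficient `1 / u^φ`, where `φ` is extended by zero outside `S`. -/
def compliance (S : Set Plane) (c : ℝ) (φ : Lp ℝ 1 (volume.restrict S)) (x : Plane) : ℝ :=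
  1 / (S.indicator φ x * (1 - c) + c)

variable {S : Set Plane} {c : ℝ} {φ : Lp ℝ 1 (volume.restrict S)}

theorem compliance_of_mem {x : Plane} (hx : x ∈ S) :
    compliance S c φ x = 1 / density S c φ x := by
  simp [compliance, density, hx]

theorem ae_indicator_mem_Icc (hS : MeasurableSet S) (hφ : φ ∈ phaseFields S) :
    ∀ᵐ x ∂(volume : Measure Plane), S.indicator φ x ∈ Set.Icc (0 : ℝ) 1 := by
  filter_upwards [(ae_restrict_iff' hS).1 hφ] with x hx
  by_cases h : x ∈ S
  · simpa [h] using hx h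
  · simp [h]

/-- Extension by zero keeps the phase field in `[0, 1]`, so the bounds also hold in the holes, where
the coefficient is `1 / c`. -/
theorem ae_compliance_bounds (hS : MeasurableSet S) (hc : 0 < c) (hφ : φ ∈ phaseFields S) :
    ∀ᵐ x ∂(volume : Measure Plane),
      1 / max 1 c ≤ compliance S c φ x ∧ compliance S c φ x ≤ 1 / min 1 c := by
  filter_upwards [ae_indicator_mem_Icc hS hφ] with x hx
  exact ⟨one_div_le_one_div_of_le (density_pos hc hx) (density_bounds hx).2,
    one_div_le_one_div_of_le (lt_min one_pos hc) (density_bounds hx).1⟩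

theorem memLp_compliance (hS : MeasurableSet S) (hc : 0 < c) (hφ : φ ∈ phaseFields S) :
    MemLp (compliance S c φ) ⊤ (volume.restrict U) := by
  have hm : AEStronglyMeasurable (S.indicator φ) (volume.restrict U) :=
    ((aestronglyMeasurable_indicator_iff hS).2 (Lp.aestronglyMeasurable φ)).restrict
  refine memLp_top_of_bound (C := 1 / min 1 c) ?_ ?_
  · exact (((hm.aemeasurable.mul_const (1 - c)).add_const c).const_div 1).aestronglyMeasurable
  · filter_upwards [ae_restrict_of_ae (ae_compliance_bounds hS hc hφ)] with x hx
    rw [Real.norm_of_nonneg (le_trans (by positivity) hx.1)]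
    exact hx.2

/-! ### Existence and uniqueness of the stress function -/

/-- The representative of `φ` is uncontrolled outside `S`, but `∇Φ` vanishes there, so `1 / density`
may be replaced by the bounded `compliance`. -/
theorem integral_stress_eq_inner (hS : MeasurableSet S) (hc : 0 < c) (hφ : φ ∈ phaseFields S)
    {Φ : L2Pair (filled S)} (hΦ : Φ ∈ admissibleStress S) (w : L2Pair (filled S)) :
    ∫ x in filled S, (1 / density S c φ x) * inner ℝ (Φ.snd x) (w.snd x) =
      inner ℝ (mulField (memLp_compliance hS hc hφ) Φ.snd) w.snd := by
  rw [inner_mulField]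
  refine integral_congr_ae ?_
  filter_upwards [(ae_restrict_diff_iff hS).1 hΦ.2] with x hx
  by_cases h : x ∈ S
  · rw [compliance_of_mem h]
  · simp [hx h]

/-- Coercivity of the form `∫ (1/u^φ) ∇Φ · ∇w` in the gradient. -/
theorem le_inner_mulField_compliance {U : Set Plane} (hS : MeasurableSet S) (hc : 0 < c)
    (hφ : φ ∈ phaseFields S) (g : Lp Plane 2 (volume.restrict U)) :
    1 / max 1 c * ‖g‖ ^ 2 ≤ inner ℝ (mulField (memLp_compliance hS hc hφ) g) g := by
  rw [norm_sq_eq_integral, ← integral_const_mul, inner_mulField]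
  have hi : Integrable (fun x => ‖g x‖ ^ 2) (volume.restrict U) :=
    (Lp.memLp g).integrable_norm_pow two_ne_zero
  refine integral_mono_ae (hi.const_mul _) ?_ ?_
  · refine (L2.integrable_inner (𝕜 := ℝ) (mulField (memLp_compliance hS hc hφ) g) g).congr ?_
    filter_upwards [coeFn_mulField (memLp_compliance hS hc hφ) g] with x hx
    rw [hx, real_inner_smul_left]
  · filter_upwards [ae_restrict_of_ae (ae_compliance_bounds hS hc hφ)] with x hx
    rw [real_inner_self_eq_norm_sq]
    exact mul_le_mul_of_nonneg_right hx.1 (by positivity)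

theorem integral_fst_eq_inner {U : Set Plane} [IsFiniteMeasure (volume.restrict U)]
    (w : Lp ℝ 2 (volume.restrict U)) :
    ∫ x in U, w x = inner ℝ ((memLp_const (1 : ℝ) (p := 2) (μ := volume.restrict U)).toLp) w := by
  rw [L2.inner_def]
  refine integral_congr_ae ?_
  filter_upwards [(memLp_const (1 : ℝ) (p := 2) (μ := volume.restrict U)).coeFn_toLp] with x hx
  rw [hx]
  simp

/-- The Lax–Milgram theorem, for a bounded functional on the right-hand side. -/
theorem _root_.IsCoercive.existsUnique_forall_eq {V : Type*} [NormedAddCommGroup V]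
    [InnerProductSpace ℝ V] [CompleteSpace V] {B : V →L[ℝ] V →L[ℝ] ℝ} (hB : IsCoercive B)
    (L : V →L[ℝ] ℝ) : ∃! v, ∀ w, B v w = L w := by
  set f : V := (InnerProductSpace.toDual ℝ V).symm L
  have hf : ∀ w, inner ℝ f w = L w := fun w => InnerProductSpace.toDual_symm_apply
  refine ⟨hB.continuousLinearEquivOfBilin.symm f, fun w => ?_, fun v hv => ?_⟩
  · rw [← hB.continuousLinearEquivOfBilin_apply, ContinuousLinearEquiv.apply_symm_apply, hf]
  · rw [ContinuousLinearEquiv.eq_symm_apply]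
    exact (hB.unique_continuousLinearEquivOfBilin fun w => by rw [hf, hv]).symm

theorem existsUnique_isPrandtlStress (hS : MeasurableSet S) (hSb : Bornology.IsBounded S)
    (hc : 0 < c) (hφ : φ ∈ phaseFields S) : ∃! Φ, IsPrandtlStress S c φ Φ := by
  have := isFiniteMeasure_restrict (isBounded_filled hSb)
  obtain ⟨C, hC0, hC⟩ := exists_poincare (isBounded_filled hSb)
  set H := stressSubmodule hS
  have hH : ∀ w : H, (w : L2Pair (filled S)) ∈ admissibleStress S := fun w =>
    (mem_stressSubmodule hS).1 w.2
  have : CompleteSpace H := (isClosed_stressSubmodule hS).completeSpace_coe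
  let G : H →L[ℝ] Lp Plane 2 (volume.restrict (filled S)) := WithLp.sndL 2 ℝ _ _ ∘L H.subtypeL
  let B : H →L[ℝ] H →L[ℝ] ℝ :=
    ((isBoundedBilinearMap_inner (𝕜 := ℝ)
      (E := Lp Plane 2 (volume.restrict (filled S)))).toContinuousLinearMap).bilinearComp
      (mulField (memLp_compliance hS hc hφ) ∘L G) G
  have hB : ∀ v w : H, B v w =
    inner ℝ (mulField (memLp_compliance hS hc hφ) (v : L2Pair (filled S)).snd)
      (w : L2Pair (filled S)).snd := fun v w => rfl
  have hcoer : IsCoercive B := by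
    -- Poincaré gives `‖v‖² ≤ (C² + 1) ‖∇v‖²`, and the form dominates `‖∇v‖² / max 1 c`.
    refine ⟨1 / max 1 c / (C ^ 2 + 1), by positivity, fun v => ?_⟩
    rw [hB]
    refine le_trans ?_ (le_inner_mulField_compliance hS hc hφ _)
    have h1 := hC _ (hH v).1
    have h2 : ‖v‖ ^ 2 = ‖(v : L2Pair (filled S)).fst‖ ^ 2 + ‖(v : L2Pair (filled S)).snd‖ ^ 2 :=
      WithLp.prod_norm_sq_eq_of_L2 _
    have h3 : ‖(v : L2Pair (filled S)).fst‖ ^ 2 ≤ C ^ 2 * ‖(v : L2Pair (filled S)).snd‖ ^ 2 := by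
      rw [← mul_pow]; gcongr
    calc 1 / max 1 c / (C ^ 2 + 1) * ‖v‖ * ‖v‖ = 1 / max 1 c / (C ^ 2 + 1) * ‖v‖ ^ 2 := by ring
      _ ≤ 1 / max 1 c / (C ^ 2 + 1) * ((C ^ 2 + 1) * ‖(v : L2Pair (filled S)).snd‖ ^ 2) := by
          gcongr; linarith
      _ = 1 / max 1 c * ‖(v : L2Pair (filled S)).snd‖ ^ 2 := by field_simp
  let L : H →L[ℝ] ℝ := (2 : ℝ) • (innerSL ℝ
    ((memLp_const (1 : ℝ) (p := 2) (μ := volume.restrict (filled S))).toLp) ∘L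
      WithLp.fstL 2 ℝ _ _ ∘L H.subtypeL)
  have hL : ∀ w : H, L w = 2 * ∫ x in filled S, (w : L2Pair (filled S)).fst x := fun w => by
    rw [integral_fst_eq_inner]; rfl
  have hiff : ∀ v : H, IsPrandtlStress S c φ v ↔ ∀ w, B v w = L w := fun v => by
    refine ⟨fun h w => ?_, fun h => ⟨hH v, fun w hw => ?_⟩⟩
    · rw [hL, hB, ← integral_stress_eq_inner hS hc hφ (hH v)]
      exact h.2 w (hH w)
    · have := h ⟨w, (mem_stressSubmodule hS).2 hw⟩
      rw [hL, hB] at this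
      rw [integral_stress_eq_inner hS hc hφ (hH v)]
      exact this
  obtain ⟨v, hv, huniq⟩ := hcoer.existsUnique_forall_eq L
  refine ⟨v, (hiff v).2 hv, fun Ψ hΨ => ?_⟩
  have hΨH : Ψ ∈ H := (mem_stressSubmodule hS).2 hΨ.1
  exact congrArg Subtype.val (huniq ⟨Ψ, hΨH⟩ ((hiff ⟨Ψ, hΨH⟩).1 hΨ))

theorem isPrandtlStress_prandtlStress (hS : MeasurableSet S) (hSb : Bornology.IsBounded S)
    (hc : 0 < c) (hφ : φ ∈ phaseFields S) : IsPrandtlStress S c φ (prandtlStress S c φ) :=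
  Classical.epsilon_spec (existsUnique_isPrandtlStress hS hSb hc hφ).exists

/-! ### Continuity of integral functionals -/

/-- Superposition functionals with bounded continuous dependence on the phase field are continuous
for the strong `L¹` topology. -/
theorem continuousOn_setIntegral {F : ℝ → Plane → ℝ} {bound : Plane → ℝ}
    (hm : ∀ φ ∈ phaseFields S, AEStronglyMeasurable (fun x => F (φ x) x) (volume.restrict S))
    (hb : ∀ᵐ x ∂volume.restrict S, ∀ t ∈ Set.Icc (0 : ℝ) 1, ‖F t x‖ ≤ bound x)
    (hi : Integrable bound (volume.restrict S))
    (hF : ∀ x, ContinuousOn (fun t => F t x) (Set.Icc 0 1)) :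
    ContinuousOn (fun φ : Lp ℝ 1 (volume.restrict S) => ∫ x in S, F (φ x) x) (phaseFields S) := by
  intro φ hφ
  -- Strong `L¹` convergence gives pointwise convergence only along a subsequence, which is enough
  -- by the subsequence criterion. The shift by `N` discards the initial terms that may lie outside
  -- `phaseFields S`.
  refine tendsto_of_subseq_tendsto fun ψ hψ => ?_
  obtain ⟨hψ1, hψ2⟩ := tendsto_nhdsWithin_iff.1 hψ
  obtain ⟨N, hN⟩ := eventually_atTop.1 hψ2
  have hψ1' : Tendsto (fun n => ψ (n + N)) atTop (𝓝 φ) := (tendsto_add_atTop_iff_nat N).2 hψ1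
  obtain ⟨ms, -, hms⟩ := (tendstoInMeasure_of_tendsto_Lp hψ1').exists_seq_tendsto_ae
  have hK : ∀ n, ψ (ms n + N) ∈ phaseFields S := fun n => hN _ (Nat.le_add_left _ _)
  refine ⟨fun n => ms n + N, tendsto_integral_of_dominated_convergence bound
    (fun n => hm _ (hK n)) hi (fun n => ?_) ?_⟩
  · filter_upwards [hb, hK n] with x h1 h2
    exact h1 _ h2
  · filter_upwards [hms, hφ, ae_all_iff.2 hK] with x h1 h2 h3
    exact (hF x _ h2).tendsto.comp
      (tendsto_nhdsWithin_iff.2 ⟨h1, Eventually.of_forall fun n => h3 n⟩)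

theorem continuousOn_integral_density_mul {f : Plane → ℝ}
    (hf : Integrable f (volume.restrict S)) :
    ContinuousOn (fun φ : Lp ℝ 1 (volume.restrict S) => ∫ x in S, density S c φ x * f x)
      (phaseFields S) := by
  refine continuousOn_setIntegral (F := fun t x => (t * (1 - c) + c) * f x)
    (bound := fun x => (|1 - c| + |c|) * ‖f x‖) (fun φ _ => ?_) ?_ (hf.norm.const_mul _)
    (fun x => by fun_prop)
  · exact (((Lp.aestronglyMeasurable φ).mul_const _).add_const _).mul hf.aestronglyMeasurable
  · refine .of_forall fun x t ht => ?_
    rw [norm_mul]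
    gcongr
    exact norm_density_le ht

/-! ### Bending rigidities -/

theorem integrable_density_mul (hφ : φ ∈ phaseFields S) {f : Plane → ℝ}
    (hf : Integrable f (volume.restrict S)) :
    Integrable (fun x => density S c φ x * f x) (volume.restrict S) := by
  refine hf.bdd_mul (c := |1 - c| + |c|)
    (((Lp.aestronglyMeasurable φ).mul_const (1 - c)).add_const c) ?_
  filter_upwards [hφ] with x hx using norm_density_le hx

theorem integrable_of_continuous (hSb : Bornology.IsBounded S) {f : Plane → ℝ}
    (hf : Continuous f) : Integrable f (volume.restrict S) :=
  (hf.continuousOn.integrableOn_compact hSb.isCompact_closure).mono_set subset_closure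

/-- A nonempty open set has positive area and the density is at least `min 1 c`; this makes the
quotient defining the centroid continuous. -/
theorem integral_density_pos (hSo : IsOpen S) (hSb : Bornology.IsBounded S) (hne : S.Nonempty)
    (hc : 0 < c) (hφ : φ ∈ phaseFields S) : 0 < ∫ x in S, density S c φ x := by
  have := isFiniteMeasure_restrict hSb
  have hi : Integrable (density S c φ) (volume.restrict S) := by
    simpa using integrable_density_mul hφ (integrable_const (1 : ℝ))
  have h1 : ∫ _ in S, min 1 c ≤ ∫ x in S, density S c φ x := by
    refine integral_mono_ae (integrable_const _) hi ?_
    filter_upwards [hφ] with x hx using (density_bounds hx).1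
  refine lt_of_lt_of_le ?_ h1
  have h2 : 0 < volume.real S :=
    ENNReal.toReal_pos (hSo.measure_pos volume hne).ne' hSb.measure_lt_top.ne
  have h3 : 0 < min 1 c := lt_min one_pos hc
  simp only [integral_const, smul_eq_mul, measureReal_restrict_apply_univ]
  positivity

theorem continuousOn_centroid (hSo : IsOpen S) (hSb : Bornology.IsBounded S) (hne : S.Nonempty)
    (hc : 0 < c) (i : Fin 2) :
    ContinuousOn (fun φ => centroid S c φ i) (phaseFields S) := by
  refine (continuousOn_integral_density_mul (integrable_of_continuous hSb (by fun_prop))).div ?_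
    fun φ hφ => (integral_density_pos hSo hSb hne hc hφ).ne'
  simpa using continuousOn_integral_density_mul (c := c)
    (integrable_of_continuous hSb (continuous_const (y := (1 : ℝ))))

/-- Expanding the product pulls the `φ`-dependent centroid out of the integrand, leaving weights
independent of `φ`. -/
theorem inertia_eq (hSb : Bornology.IsBounded S) (hφ : φ ∈ phaseFields S) (i j : Fin 2) :
    inertia S c φ i j = (∫ x in S, density S c φ x * (x i * x j))
      - centroid S c φ j * (∫ x in S, density S c φ x * x i)
      - centroid S c φ i * (∫ x in S, density S c φ x * x j)
      + centroid S c φ i * centroid S c φ j * (∫ x in S, density S c φ x * 1) := by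
  have I : ∀ f : Plane → ℝ, Continuous f →
      Integrable (fun x => density S c φ x * f x) (volume.restrict S) := fun f hf =>
    integrable_density_mul hφ (integrable_of_continuous hSb hf)
  have i1 := I (fun x => x i * x j) (by fun_prop)
  have i2 := (I (fun x => x i) (by fun_prop)).const_mul (centroid S c φ j)
  have i3 := (I (fun x => x j) (by fun_prop)).const_mul (centroid S c φ i)
  have i4 := (I (fun _ => 1) (by fun_prop)).const_mul (centroid S c φ i * centroid S c φ j)
  have i12 : Integrable (fun x : Plane => density S c φ x * (x i * x j) -
    centroid S c φ j * (density S c φ x * x i)) (volume.restrict S) := i1.sub i2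
  have i123 : Integrable (fun x : Plane => density S c φ x * (x i * x j) -
    centroid S c φ j * (density S c φ x * x i) - centroid S c φ i * (density S c φ x * x j))
    (volume.restrict S) := i12.sub i3
  rw [← integral_const_mul, ← integral_const_mul, ← integral_const_mul, ← integral_sub i1 i2,
    ← integral_sub i12 i3, ← integral_add i123 i4, inertia]
  congr 1
  ext x
  ring

theorem continuousOn_inertia (hSo : IsOpen S) (hSb : Bornology.IsBounded S) (hne : S.Nonempty)
    (hc : 0 < c) (i j : Fin 2) :
    ContinuousOn (fun φ => inertia S c φ i j) (phaseFields S) := by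
  have D : ∀ f : Plane → ℝ, Continuous f → ContinuousOn
      (fun φ : Lp ℝ 1 (volume.restrict S) => ∫ x in S, density S c φ x * f x) (phaseFields S) :=
    fun f hf => continuousOn_integral_density_mul (integrable_of_continuous hSb hf)
  have Z := continuousOn_centroid hSo hSb hne hc
  refine ContinuousOn.congr ?_ fun φ hφ => inertia_eq hSb hφ i j
  exact (((D _ (by fun_prop)).sub ((Z j).mul (D _ (by fun_prop)))).sub
    ((Z i).mul (D _ (by fun_prop)))).add (((Z i).mul (Z j)).mul (D _ continuous_const))

/-! ### Torsional rigidity -/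

theorem mulField_sub {U : Set Plane} {κ₁ κ₂ : Plane → ℝ} (h₁ : MemLp κ₁ ⊤ (volume.restrict U))
    (h₂ : MemLp κ₂ ⊤ (volume.restrict U)) (g : Lp Plane 2 (volume.restrict U)) :
    mulField (h₁.sub h₂) g = mulField h₁ g - mulField h₂ g := by
  refine Lp.ext ?_
  filter_upwards [coeFn_mulField (h₁.sub h₂) g, coeFn_mulField h₁ g, coeFn_mulField h₂ g,
    Lp.coeFn_sub (mulField h₁ g) (mulField h₂ g)] with x e e₁ e₂ e₃
  rw [e, e₃, Pi.sub_apply, Pi.sub_apply, e₁, e₂, sub_smul]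

theorem inner_mulField_comm {U : Set Plane} {κ : Plane → ℝ} (hκ : MemLp κ ⊤ (volume.restrict U))
    (g h : Lp Plane 2 (volume.restrict U)) :
    inner ℝ (mulField hκ g) h = inner ℝ (mulField hκ h) g := by
  rw [inner_mulField, inner_mulField]
  exact integral_congr_ae (.of_forall fun x => congrArg (κ x * ·) (real_inner_comm _ _))

theorem IsPrandtlStress.inner_eq (hS : MeasurableSet S) (hc : 0 < c) (hφ : φ ∈ phaseFields S)
    {Φ w : L2Pair (filled S)} (hΦ : IsPrandtlStress S c φ Φ) (hw : w ∈ admissibleStress S) :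
    inner ℝ (mulField (memLp_compliance hS hc hφ) Φ.snd) w.snd =
      2 * ∫ x in filled S, w.fst x :=
  (integral_stress_eq_inner hS hc hφ hΦ.1 w).symm.trans (hΦ.2 w hw)

/-- Test the equation of `Φ` with `Ψ` and that of `Ψ` with `Φ`; the forms are symmetric and share
the same load, so only the difference of the coefficients survives. -/
theorem IsPrandtlStress.integral_sub (hS : MeasurableSet S) (hc : 0 < c)
    {ψ : Lp ℝ 1 (volume.restrict S)} (hφ : φ ∈ phaseFields S) (hψ : ψ ∈ phaseFields S)
    {Φ Ψ : L2Pair (filled S)} (hΦ : IsPrandtlStress S c φ Φ) (hΨ : IsPrandtlStress S c ψ Ψ) :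
    2 * (∫ x in filled S, Ψ.fst x) - 2 * (∫ x in filled S, Φ.fst x) =
      inner ℝ (mulField ((memLp_compliance hS hc hφ).sub (memLp_compliance hS hc hψ)) Φ.snd)
        Ψ.snd := by
  rw [mulField_sub (memLp_compliance hS hc hφ) (memLp_compliance hS hc hψ), inner_sub_left,
    hΦ.inner_eq hS hc hφ hΨ.1, inner_mulField_comm,
    hΨ.inner_eq hS hc hψ hΦ.1]

theorem torsionalRigidity_sub (hS : MeasurableSet S) (hSb : Bornology.IsBounded S)
    (hc : 0 < c) {ψ : Lp ℝ 1 (volume.restrict S)} (hφ : φ ∈ phaseFields S)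
    (hψ : ψ ∈ phaseFields S) :
    torsionalRigidity S c ψ - torsionalRigidity S c φ =
      inner ℝ (mulField ((memLp_compliance hS hc hφ).sub (memLp_compliance hS hc hψ))
        (prandtlStress S c φ).snd) (prandtlStress S c ψ).snd :=
  (isPrandtlStress_prandtlStress hS hSb hc hφ).integral_sub hS hc hφ hψ
    (isPrandtlStress_prandtlStress hS hSb hc hψ)

/-- An a priori bound on the stress functions that is uniform in the phase field. -/
theorem exists_norm_prandtlStress_le (hS : MeasurableSet S) (hSb : Bornology.IsBounded S)
    (hc : 0 < c) : ∃ K : ℝ, ∀ φ ∈ phaseFields S, ‖(prandtlStress S c φ).snd‖ ≤ K := by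
  have := isFiniteMeasure_restrict (isBounded_filled hSb)
  obtain ⟨C, hC0, hC⟩ := exists_poincare (isBounded_filled hSb)
  set A := ‖(memLp_const (1 : ℝ) (p := 2) (μ := volume.restrict (filled S))).toLp‖
  -- Testing with the solution itself, with `g` the gradient norm, gives `g² / max 1 c ≤ 2 ∫ Φ ≤ 2 A
  -- C g`; then divide by `g` unless it is zero.
  refine ⟨max 1 c * (2 * A * C), fun φ hφ => ?_⟩
  have p := isPrandtlStress_prandtlStress hS hSb hc hφ
  have h1 := p.2 _ p.1
  rw [integral_stress_eq_inner hS hc hφ p.1, integral_fst_eq_inner] at h1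
  have h2 := le_inner_mulField_compliance hS hc hφ (prandtlStress S c φ).snd
  have h3 := real_inner_le_norm
    ((memLp_const (1 : ℝ) (p := 2) (μ := volume.restrict (filled S))).toLp)
    (prandtlStress S c φ).fst
  have h4 := hC _ p.1.1
  set g := ‖(prandtlStress S c φ).snd‖
  have hA : 0 ≤ A := norm_nonneg _
  have h5 : 1 / max 1 c * g ^ 2 ≤ 2 * (A * (C * g)) := by
    refine (h2.trans_eq h1).trans ?_
    have := h3.trans (mul_le_mul_of_nonneg_left h4 hA)
    linarith
  have hmax : 0 < max 1 c := lt_max_of_lt_left one_pos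
  have h6 : g * g ≤ (max 1 c * (2 * A * C)) * g := by
    have := mul_le_mul_of_nonneg_left h5 hmax.le
    rw [← mul_assoc, mul_one_div_cancel hmax.ne'] at this
    linarith
  rcases (norm_nonneg (prandtlStress S c φ).snd).eq_or_lt with h0 | h0
  · change 0 = g at h0
    rw [← h0]; positivity
  · exact le_of_mul_le_mul_right h6 h0

theorem continuousOn_torsionalRigidity (hS : MeasurableSet S) (hSb : Bornology.IsBounded S)
    (hc : 0 < c) : ContinuousOn (torsionalRigidity S c) (phaseFields S) := by
  intro φ hφ
  obtain ⟨K, hK⟩ := exists_norm_prandtlStress_le hS hSb hc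
  have p := isPrandtlStress_prandtlStress hS hSb hc hφ
  set g := (prandtlStress S c φ).snd
  -- The squared integrand of the first Cauchy–Schwarz factor, with `φ` and its gradient field `g`
  -- frozen; only `t`, the value of `ψ`, varies.
  set F : ℝ → Plane → ℝ := fun t x =>
    (1 / (φ x * (1 - c) + c) - 1 / (t * (1 - c) + c)) ^ 2 * ‖g x‖ ^ 2 with hFdef
  have hle : volume.restrict S ≤ volume.restrict (filled S) :=
    Measure.restrict_mono (subset_filled S) le_rfl
  have hgS : MemLp g 2 (volume.restrict S) := (Lp.memLp g).mono_measure hle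
  have hgi : Integrable (fun x => ‖g x‖ ^ 2) (volume.restrict S) :=
    hgS.integrable_norm_pow two_ne_zero
  have hcont : ContinuousOn (fun ψ : Lp ℝ 1 (volume.restrict S) => ∫ x in S, F (ψ x) x)
      (phaseFields S) := by
    refine continuousOn_setIntegral (bound := fun x => (1 / min 1 c) ^ 2 * ‖g x‖ ^ 2)
      (fun ψ _ => ?_) ?_ (hgi.const_mul _) fun x => ?_
    · have hu : ∀ χ : Lp ℝ 1 (volume.restrict S),
          AEMeasurable (fun x => 1 / (χ x * (1 - c) + c)) (volume.restrict S) := fun χ =>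
        (((Lp.aestronglyMeasurable χ).aemeasurable.mul_const _).add_const _).const_div 1
      exact (((hu φ).sub (hu ψ)).pow_const 2).aestronglyMeasurable.mul hgi.aestronglyMeasurable
    · filter_upwards [hφ] with x hx t ht
      have hmin : 0 < min 1 c := lt_min one_pos hc
      have b : ∀ s ∈ Set.Icc (0 : ℝ) 1, 0 ≤ 1 / (s * (1 - c) + c) ∧
          1 / (s * (1 - c) + c) ≤ 1 / min 1 c := fun s hs =>
        ⟨(one_div_pos.2 (density_pos hc hs)).le,
          one_div_le_one_div_of_le hmin (density_bounds hs).1⟩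
      -- Both reciprocals lie in `[0, 1 / min 1 c]`, hence so does the absolute value of their
      -- difference.
      rw [hFdef, Real.norm_of_nonneg (by positivity)]
      refine mul_le_mul_of_nonneg_right (sq_le_sq' ?_ ?_) (by positivity)
      · linarith [(b _ hx).1, (b _ ht).2]
      · linarith [(b _ hx).2, (b _ ht).1]
    · have : ContinuousOn (fun t : ℝ => 1 / (t * (1 - c) + c)) (Set.Icc 0 1) :=
        continuousOn_const.div (by fun_prop) fun t ht => (density_pos hc ht).ne'
      exact ((continuousOn_const.sub this).pow 2).mul continuousOn_const
  have h0 : ∫ x in S, F (φ x) x = 0 := by simp [F]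
  have hnorm : ∀ ψ (hψ : ψ ∈ phaseFields S),
      ‖mulField (U := filled S) ((memLp_compliance hS hc hφ).sub (memLp_compliance hS hc hψ)) g‖
        = √(∫ x in S, F (ψ x) x) := fun ψ hψ => by
    rw [← Real.sqrt_sq (norm_nonneg (mulField _ g)), norm_sq_eq_integral]
    congr 1
    -- Since `g` vanishes a.e. in the holes, the integral over `filled S` reduces to one over `S`,
    -- where `φ` and `ψ` are controlled.
    have e := setIntegral_indicator (s := filled S) (μ := volume) (f := fun x => F (ψ x) x) hS
    rw [Set.inter_eq_right.2 (subset_filled S)] at e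
    rw [← e]
    refine integral_congr_ae ?_
    filter_upwards [coeFn_mulField ((memLp_compliance hS hc hφ).sub (memLp_compliance hS hc hψ)) g,
      (ae_restrict_diff_iff hS).1 p.1.2] with x h1 h2
    rw [h1, norm_smul, mul_pow, Real.norm_eq_abs, sq_abs]
    by_cases hx : x ∈ S
    · simp only [Set.indicator_of_mem hx, Pi.sub_apply, compliance_of_mem hx, density, F]
    · simp [hx, g, h2 hx]
  have hlim : Tendsto (fun ψ : Lp ℝ 1 (volume.restrict S) => √(∫ x in S, F (ψ x) x) * K)
      (𝓝[phaseFields S] φ) (𝓝 0) := by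
    have := ((hcont φ hφ).tendsto.sqrt).mul_const K
    rwa [h0, Real.sqrt_zero, zero_mul] at this
  refine tendsto_iff_norm_sub_tendsto_zero.2
    (squeeze_zero' (.of_forall fun _ => norm_nonneg _) ?_ hlim)
  filter_upwards [self_mem_nhdsWithin] with ψ hψ
  rw [torsionalRigidity_sub hS hSb hc hφ hψ, ← hnorm ψ hψ]
  exact (norm_inner_le_norm _ _).trans (mul_le_mul_of_nonneg_left (hK ψ hψ) (norm_nonneg _))

end Rod
end

theorem lemma3p3 (S : Set Rod.Plane) (hSo : IsOpen S) (hSb : Bornology.IsBounded S)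
    (hSc : IsConnected S) (c : ℝ) (hc : 0 < c) (mu lam : ℝ) (hml : lam + mu ≠ 0) :
    (∀ φ ∈ Rod.phaseFields S, ∃! Φ : Rod.L2Pair (Rod.filled S), Rod.IsPrandtlStress S c φ Φ) ∧
    ∀ σ₁ σ₂ σ₃ : ℝ,
      ContinuousOn
        (fun φ : Lp ℝ 1 (volume.restrict S) =>
          σ₁ * Rod.meanRigidity S c mu lam φ + σ₂ * Rod.nonsymmetricRigidity S c mu lam φ
            + mu * σ₃ * Rod.torsionalRigidity S c φ)
        (Rod.phaseFields S) := by
  have hS := hSo.measurableSet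
  refine ⟨fun φ hφ => Rod.existsUnique_isPrandtlStress hS hSb hc hφ, fun σ₁ σ₂ σ₃ => ?_⟩
  have I := Rod.continuousOn_inertia hSo hSb hSc.nonempty hc
  have hM : ContinuousOn (Rod.meanRigidity S c mu lam) (Rod.phaseFields S) :=
    continuousOn_const.mul (((I 0 0).add (I 1 1)).div_const 2)
  have hN : ContinuousOn (Rod.nonsymmetricRigidity S c mu lam) (Rod.phaseFields S) :=
    continuousOn_const.mul
      (((((I 0 0).sub (I 1 1)).pow 2).div_const 4).add ((I 0 1).pow 2)).sqrt
  exact ((continuousOn_const.mul hM).add (continuousOn_const.mul hN)).add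
    (continuousOn_const.mul (Rod.continuousOn_torsionalRigidity hS hSb hc))
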